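/- Let $F$ be a field of characteristic zero and let $F\langle X,\mathrm{Tr}\rangle=F\langle X\rangle\otimes F[\mathrm{Tr}(M)]$ be the free algebra with trace on $X=\{x_1,x_2,\dots\}$, where $M$ runs over the nonempty words in $X$ and the $\mathrm{Tr}(M)$ are central commuting variables subject to $\mathrm{Tr}(MN)=\mathrm{Tr}(NM)$; the formal trace is extended $F[\mathrm{Tr}(M)]$-linearly. For a unitary algebra $A$ with trace $\mathrm{tr}:A\to F$ (a linear map with $\mathrm{tr}(ab)=\mathrm{tr}(ba)$), let $\mathrm{Id}^{tr}(A)$ be the ideal of those trace polynomials that vanish under every evaluation $x_i\mapsto a_i\in A$, $\mathrm{Tr}\mapsto\mathrm{tr}$, let $MT_n$ be the span of the trace monomials $\mathrm{Tr}(M_1)\cdots\mathrm{Tr}(M_k)M$ in which each of $x_1,\dots,x_n$ occurs exactly once and no other variable occurs, and let $c_n^{tr}(A)=\dim_F MT_n/(MT_n\cap \mathrm{Id}^{tr}(A))$. A trace $T$-ideal is a two-sided ideal of $F\langle X,\mathrm{Tr}\rangle$ that is invariant under all endomorphisms commuting with the formal trace; since $\mathrm{Tr}(1)$ is not an element of $F\langle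 X,\mathrm{Tr}\rangle$, these are the substitutions of the variables by linear combinations of trace monomials $\mathrm{Tr}(M_1)\cdots\mathrm{Tr}(M_k)M$ with $M$ nonempty. Let $\alpha\in F$, $\alpha\neq0$, and let $D_3^{t_{\alpha,\alpha,0}}$ be the algebra of diagonal $3\times3$ matrices over $F$ with the trace $\mathrm{diag}(a,b,c)\mapsto\alpha a+\alpha b$. Then $\mathrm{Id}^{tr}(D_3^{t_{\alpha,\alpha,0}})$ is generated, as a trace $T$-ideal, by $$f_1=[x_1,x_2]$$ and $$g_3=\mathrm{Tr}(x_1)\mathrm{Tr}(x_2)\mathrm{Tr}(x_3)+2\alpha^2\mathrm{Tr}(x_1x_2x_3)-\alpha\mathrm{Tr}(x_1)\mathrm{Tr}(x_2x_3)-\alpha\mathrm{Tr}(x_2)\mathrm{Tr}(x_1x_3)-\alpha\mathrm{Tr}(x_1x_2)\mathrm{Tr}(x_3).$$ The same holds if the formal trace is normalised by $\mathrm{Tr}(1)=\mathrm{tr}(1)=2\alpha$ and trace $T$-ideals are moreover required to be closed under the formal trace $f\mapsto\mathrm{Tr}(f)$ and invariant under all substitutions of the variables by arbitrary trace polynomials.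 Modulo the trace $T$-ideal, in this last sense, generated by $f_1$, one has $g_3\equiv\mathrm{Tr}(f_3x_3)$, where $$f_3=\mathrm{Tr}(x_1)\mathrm{Tr}(x_2)+\alpha^2x_1x_2+\alpha^2x_2x_1-\alpha\mathrm{Tr}(x_1)x_2-\alpha\mathrm{Tr}(x_2)x_1-\alpha\mathrm{Tr}(x_1x_2).$$ Moreover, for every $n\ge0$, $$c_n^{tr}(D_3^{t_{\alpha,\alpha,0}})=\sum_{k=0}^n\binom nk+\sum_{t=2}^n\binom nt S(t,2)=2^n+S(n+1,3)=\frac{3^n+1}{2},$$ where $S(n,k)$ denotes the Stirling numbers of the second kind. -/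

import Mathlib

noncomputable section

/-!
The variable `x_{i+1}` of the countable alphabet `X = {x₁, x₂, …}` has index `i : ℕ`.
-/

/-- Nonempty words in the alphabet `X` up to cyclic rotation: the index set of the commuting
variables `Tr(M)`, subject to `Tr(MN) = Tr(NM)`. -/
def CyclicWord : Type := {c : Cycle ℕ // c ≠ Cycle.nil}

/-- The cyclic word of a nonempty word. -/
def CyclicWord.ofList (l : List ℕ) (h : l ≠ []) : CyclicWord :=
  ⟨(l : Cycle ℕ), fun h' => h (by simpa using h')⟩

/-- The letters of a cyclic word, with multiplicity. -/
def CyclicWord.letters (c : CyclicWord) : Multiset ℕ := c.1.toMultiset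

/-- The commutative polynomial algebra `F[Tr(M)]`, with `M` a nonempty word. -/
abbrev TraceRing (F : Type*) [Field F] : Type _ := MvPolynomial CyclicWord F

/-- The free algebra with trace `F⟨X, Tr⟩ = F⟨X⟩ ⊗ F[Tr(M)]`, realised as the algebra of the free
monoid of words in `X` with coefficients in `F[Tr(M)]`. -/
abbrev FreeTraceAlgebra (F : Type*) [Field F] : Type _ :=
  MonoidAlgebra (TraceRing F) (FreeMonoid ℕ)

namespace FreeTraceAlgebra

variable {F : Type*} [Field F]

/-- The free generator with index `i`. -/
def x (i : ℕ) : FreeTraceAlgebra F := MonoidAlgebra.of (TraceRing F) (FreeMonoid ℕ) (FreeMonoid.of i)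

/-- The formal trace `Tr(x_{i₁} ⋯ x_{i_k})` of a nonempty word. -/
def T (l : List ℕ) (h : l ≠ [] := by simp) : FreeTraceAlgebra F :=
  algebraMap (TraceRing F) (FreeTraceAlgebra F) (MvPolynomial.X (CyclicWord.ofList l h))

/-- The trace of a word, where the trace of the empty word is set to be the scalar `δ`. -/
def wordTrace (δ : F) (w : FreeMonoid ℕ) : TraceRing F :=
  if h : w.toList = [] then MvPolynomial.C δ else MvPolynomial.X (CyclicWord.ofList w.toList h)

/-- The formal trace on `F⟨X, Tr⟩`: it is linear over `F[Tr(M)]` (so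
`Tr(Tr(M)N) = Tr(M)Tr(N)`), sends a nonempty word `M` to the variable `Tr(M)`,
and has `Tr(1) = δ`. -/
def Tr (δ : F) : FreeTraceAlgebra F →ₗ[TraceRing F] FreeTraceAlgebra F :=
  Algebra.linearMap (TraceRing F) (FreeTraceAlgebra F) ∘ₗ
    Finsupp.linearCombination (TraceRing F) (wordTrace δ) ∘ₗ
      (MonoidAlgebra.coeffLinearEquiv (TraceRing F)).toLinearMap

/-- The algebra endomorphism `φ` commutes with the formal trace normalised by `Tr(1) = δ`. -/
def CommutesWithTr (δ : F) (φ : FreeTraceAlgebra F →ₐ[F] FreeTraceAlgebra F) : Prop :=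
  ∀ f, φ (Tr δ f) = Tr δ (φ f)

/-- A trace `T`-ideal: a two-sided ideal of `F⟨X, Tr⟩` invariant under the endomorphisms of
`F⟨X, Tr⟩` as an algebra with trace. As `Tr(1)` is not an element of `F⟨X, Tr⟩`, these are the
algebra endomorphisms that commute with the formal trace whatever value `Tr(1)` is given, that is,
the substitutions of the variables by combinations of trace monomials
`Tr(M₁) ⋯ Tr(M_k) M` with `M` nonempty. -/
def IsTraceTIdeal (I : TwoSidedIdeal (FreeTraceAlgebra F)) : Prop :=
  ∀ φ : FreeTraceAlgebra F →ₐ[F] FreeTraceAlgebra F, (∀ δ : F, CommutesWithTr δ φ) →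
    ∀ f ∈ I, φ f ∈ I

/-- The stronger closure property of the trace `T`-ideals of unitary algebras with `tr(1) = δ`: the
ideal is closed under the formal trace with `Tr(1) = δ` and invariant under all endomorphisms that
commute with that trace (arbitrary substitutions of the variables, constants included). -/
structure IsUnitalTraceTIdeal (δ : F) (I : TwoSidedIdeal (FreeTraceAlgebra F)) : Prop where
  tr_mem : ∀ f ∈ I, Tr δ f ∈ I
  map_mem : ∀ φ : FreeTraceAlgebra F →ₐ[F] FreeTraceAlgebra F, CommutesWithTr δ φ →
    ∀ f ∈ I, φ f ∈ I

/-- `MT_n`: the multilinear trace polynomials in the first `n` variables, spanned by the monomials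
`Tr(M₁) ⋯ Tr(M_k) M` in which each of the first `n` variables occurs exactly once and no other
variable occurs. -/
def MT (F : Type*) [Field F] (n : ℕ) : Submodule F (FreeTraceAlgebra F) :=
  Submodule.span F {m | ∃ (s : Multiset CyclicWord) (w : FreeMonoid ℕ),
    (s.map CyclicWord.letters).sum + (w.toList : Multiset ℕ) = Multiset.range n ∧
    m = MonoidAlgebra.single w ((s.map MvPolynomial.X).prod : TraceRing F)}

end FreeTraceAlgebra

/-- `dim_F M / (M ∩ N)` for subspaces `M`, `N` of a vector space. -/
def quotientDim {F V : Type*} [Field F] [AddCommGroup V] [Module F V] (M N : Submodule F V) : ℕ :=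
  Module.finrank F (M ⧸ N.comap M.subtype)

/-- A trace on an `F`-algebra `A`: a linear map `tr : A → F` with `tr(ab) = tr(ba)`. -/
structure AlgTrace (F A : Type*) [Field F] [Ring A] [Algebra F A] where
  toLin : A →ₗ[F] F
  map_mul_comm : ∀ a b : A, toLin (a * b) = toLin (b * a)

namespace AlgTrace

variable {F A : Type*} [Field F] [Ring A] [Algebra F A]

/-- The value `tr(a_{i₁} ⋯ a_{i_k})` on the cyclic word of `x_{i₁} ⋯ x_{i_k}`. -/
def cycleValue (t : AlgTrace F A) (a : ℕ → A) (c : Cycle ℕ) : F :=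
  Quotient.liftOn c (fun l : List ℕ => t.toLin (l.map a).prod) (by
    rintro l l' ⟨k, rfl⟩
    show t.toLin (l.map a).prod = t.toLin ((l.rotate k).map a).prod
    rw [List.rotate_eq_drop_append_take_mod, List.map_append, List.prod_append, t.map_mul_comm,
      ← List.prod_append, ← List.map_append, List.take_append_drop])

/-- The evaluation of trace polynomials at `x_i ↦ a_i`, `Tr ↦ tr`. -/
def eval (t : AlgTrace F A) (a : ℕ → A) : FreeTraceAlgebra F →ₐ[F] A :=
  MonoidAlgebra.liftNCAlgHom
    ((Algebra.ofId F A).comp (MvPolynomial.aeval fun c : CyclicWord => t.cycleValue a c.1))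
    (FreeMonoid.lift a)
    (fun _ _ => Algebra.commutes _ _)

/-- `Id^tr(A)`: the two-sided ideal of the trace polynomials all of whose evaluations on `A`
vanish. -/
def identities (t : AlgTrace F A) : TwoSidedIdeal (FreeTraceAlgebra F) :=
  ⨅ a : ℕ → A, TwoSidedIdeal.ker (t.eval a)

theorem mem_identities (t : AlgTrace F A) (f : FreeTraceAlgebra F) :
    f ∈ t.identities ↔ ∀ a : ℕ → A, t.eval a f = 0 := by
  simp [identities, TwoSidedIdeal.mem_iInf, TwoSidedIdeal.mem_ker]

/-- The `n`-th trace codimension `dim_F MT_n / (MT_n ∩ Id^tr(A))`. -/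
def codim (t : AlgTrace F A) (n : ℕ) : ℕ :=
  quotientDim (FreeTraceAlgebra.MT F n) (t.identities.asIdeal.restrictScalars F)

end AlgTrace

/-- The algebra `D_n` of diagonal `n × n` matrices. -/
abbrev DiagAlg (F : Type*) [Field F] (n : ℕ) : Subalgebra F (Matrix (Fin n) (Fin n) F) :=
  (Matrix.diagonalAlgHom (n := Fin n) (α := F) F).range

/-- The trace `t_{α₁,…,α_n}` on `D_n`: `diag(a₁₁,…,a_nn) ↦ α₁ a₁₁ + ⋯ + α_n a_nn`. -/
def diagTrace {F : Type*} [Field F] {n : ℕ} (α : Fin n → F) : AlgTrace F (DiagAlg F n) where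
  toLin :=
    { toFun := fun a => ∑ i, α i * (a : Matrix (Fin n) (Fin n) F) i i
      map_add' := fun a b => by simp [mul_add, Finset.sum_add_distrib]
      map_smul' := fun c a => by simp [Finset.mul_sum, mul_left_comm] }
  map_mul_comm := by
    rintro ⟨_, u, rfl⟩ ⟨_, v, rfl⟩
    simp [mul_comm]

namespace FreeTraceAlgebra

variable {F : Type*} [Field F]

/-- `f₁ = [x₁, x₂]`. -/
def f₁ : FreeTraceAlgebra F := x 0 * x 1 - x 1 * x 0

/-- `f₃ = Tr(x₁)Tr(x₂) + α²x₁x₂ + α²x₂x₁ - αTr(x₁)x₂ - αTr(x₂)x₁ - αTr(x₁x₂)`. -/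
def f₃ (α : F) : FreeTraceAlgebra F :=
  T [0] * T [1] + α ^ 2 • (x 0 * x 1) + α ^ 2 • (x 1 * x 0)
    - α • (T [0] * x 1) - α • (T [1] * x 0) - α • T [0, 1]

/-- `g₃ = Tr(x₁)Tr(x₂)Tr(x₃) + 2α²Tr(x₁x₂x₃) - αTr(x₁)Tr(x₂x₃) - αTr(x₂)Tr(x₁x₃)
- αTr(x₁x₂)Tr(x₃)`. -/
def g₃ (α : F) : FreeTraceAlgebra F :=
  T [0] * T [1] * T [2] + (2 * α ^ 2) • T [0, 1, 2]
    - α • (T [0] * T [1, 2]) - α • (T [1] * T [0, 2]) - α • (T [0, 1] * T [2])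

end FreeTraceAlgebra

end

/-! Evaluate a trace polynomial at generic diagonal matrices with entries `X (k, i)` and keep only
the last entry, `genericEntry`: a word becomes its monomial in the entries of index 2, and the trace
of a word becomes α times the sum of its monomials at entries 0 and 1. Identities are killed by this
map, since F is infinite.

Conversely, `polynomialLift` is a linear inverse modulo any trace T-ideal I containing f₁ and g₃. It
sends a monomial with letters p, q, w at the entries 0, 1, 2 to S(p,q)·w, where S(p,q) = (Tr(p)Tr(q)
- αTr(pq))/(2α²) (`symmCoef`). The relation g₃(p,q,u) says exactly that Tr(u)S(p,q) = α(S(pu,q) +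
S(p,qu)) up to order inside traces, which is how the generic trace of u acts on monomials
(`polynomialLift_genericTrace_mul`). Hence every f is congruent mod I to the lift of its generic
entry (`polynomialLift_genericEntry_sub_mem`), and a vanishing generic entry puts f in I.

For the codimension, the multilinear monomials in n matrices correspond to functions `Fin n → Fin
3`, and the generic entries of `MT F n` are exactly the combinations invariant under exchanging the
values 0 and 1 (`map_entryCoeffs_MT`). The involution fixes one function, so this space has
dimension (3^n + 1)/2. -/

noncomputable section

/-! ### Monomials of the free algebra with trace, and substitutions of words -/

namespace FreeTraceAlgebra

variable {F : Type*} [Field F]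

/-- The trace polynomial given by a word. -/
def word : FreeMonoid ℕ →* FreeTraceAlgebra F :=
  MonoidAlgebra.of (TraceRing F) (FreeMonoid ℕ)

/-- A central coefficient, as a trace polynomial. -/
def coef : TraceRing F →ₐ[F] FreeTraceAlgebra F :=
  IsScalarTower.toAlgHom F (TraceRing F) (FreeTraceAlgebra F)

theorem coef_commute (r : TraceRing F) (f : FreeTraceAlgebra F) : Commute (coef r) f :=
  Algebra.commutes r f

theorem single_eq_coef_mul_word (w : FreeMonoid ℕ) (r : TraceRing F) :
    (MonoidAlgebra.single w r : FreeTraceAlgebra F) = coef r * word w := by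
  simp [coef, word, MonoidAlgebra.coe_algebraMap, MonoidAlgebra.single_mul_single]

theorem coef_C (c : F) : (coef (MvPolynomial.C c) : FreeTraceAlgebra F) = algebraMap F _ c := by
  rw [← MvPolynomial.algebraMap_eq, AlgHom.commutes]

theorem x_eq_word (i : ℕ) : (x i : FreeTraceAlgebra F) = word (FreeMonoid.of i) := rfl

theorem wordTrace_one (δ : F) : wordTrace δ 1 = MvPolynomial.C δ := by
  simp [wordTrace]

theorem wordTrace_ofList_nil (δ : F) :
    wordTrace δ (FreeMonoid.ofList []) = MvPolynomial.C δ := wordTrace_one δ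

theorem wordTrace_of_ne (δ : F) (l : List ℕ) (h : l ≠ []) :
    wordTrace δ (FreeMonoid.ofList l) = MvPolynomial.X (CyclicWord.ofList l h) := by
  rw [wordTrace, dif_neg]
  rfl

theorem T_eq (δ : F) (l : List ℕ) (h : l ≠ []) :
    (T l h : FreeTraceAlgebra F) = coef (wordTrace δ (FreeMonoid.ofList l)) := by
  rw [wordTrace_of_ne δ l h]; rfl

theorem wordTrace_mul_comm (δ : F) (u v : FreeMonoid ℕ) :
    wordTrace δ (u * v) = wordTrace δ (v * u) := by
  by_cases h : (u * v).toList = []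
  · have h' : (v * u).toList = [] := by
      simp only [FreeMonoid.toList_mul, List.append_eq_nil_iff] at h ⊢
      exact h.symm
    rw [wordTrace, wordTrace, dif_pos h, dif_pos h']
  · have h' : ¬ (v * u).toList = [] := by
      simp only [FreeMonoid.toList_mul, List.append_eq_nil_iff] at h ⊢
      exact fun h' => h h'.symm
    rw [wordTrace, wordTrace, dif_neg h, dif_neg h']
    congr 1
    apply Subtype.ext
    show ((u * v).toList : Cycle ℕ) = ((v * u).toList : Cycle ℕ)
    rw [Cycle.coe_eq_coe, FreeMonoid.toList_mul, FreeMonoid.toList_mul]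
    exact List.isRotated_append

theorem Tr_coef_mul_word (δ : F) (r : TraceRing F) (w : FreeMonoid ℕ) :
    Tr δ (coef r * word w) = coef (r * wordTrace δ w) := by
  rw [← single_eq_coef_mul_word]
  simp [Tr, Finsupp.linearCombination_single, coef]

theorem Tr_word (δ : F) (w : FreeMonoid ℕ) :
    Tr δ (word w : FreeTraceAlgebra F) = coef (wordTrace δ w) := by
  simpa using Tr_coef_mul_word δ 1 w

theorem Tr_coef_mul (δ : F) (r : TraceRing F) (f : FreeTraceAlgebra F) :
    Tr δ (coef r * f) = coef r * Tr δ f := by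
  rw [show coef r * f = r • f from (Algebra.smul_def r f).symm, map_smul, Algebra.smul_def]; rfl

theorem induction_coef_mul_word {p : FreeTraceAlgebra F → Prop} (f : FreeTraceAlgebra F)
    (add : ∀ f g, p f → p g → p (f + g)) (mono : ∀ r w, p (coef r * word w)) : p f := by
  induction f using MonoidAlgebra.induction_linear with
  | zero => simpa using mono 0 1
  | add f g hf hg => exact add f g hf hg
  | single w r => rw [single_eq_coef_mul_word]; exact mono r w

/-- Algebra homomorphisms out of the free algebra with trace agree as soon as they agree on the
variables and on the traces of words. -/
theorem algHom_ext_traces {A : Type*} [Ring A] [Algebra F A] {φ ψ : FreeTraceAlgebra F →ₐ[F] A}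
    (hx : ∀ i, φ (x i) = ψ (x i))
    (hT : ∀ l (h : l ≠ []), φ (T l h) = ψ (T l h)) : φ = ψ := by
  have hw : ∀ w : FreeMonoid ℕ, φ (word w) = ψ (word w) := by
    intro w
    induction w using FreeMonoid.inductionOn' with
    | one => simp
    | of_mul i w ih =>
      rw [map_mul, map_mul, map_mul, ih]
      exact congrArg (· * _) (hx i)
  have hc : ∀ r : TraceRing F, φ (coef r) = ψ (coef r) := by
    intro r
    induction r using MvPolynomial.induction_on with
    | C c => rw [coef_C, φ.commutes, ψ.commutes]
    | add r s hr hs => rw [map_add, map_add, map_add, hr, hs]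
    | mul_X r c hr =>
      rw [map_mul, map_mul, map_mul, hr]
      congr 1
      obtain ⟨c, hc⟩ := c
      induction c using Cycle.induction_on with
      | nil => exact absurd rfl hc
      | cons a l _ => exact hT (a :: l) (by simp)
  refine AlgHom.ext fun f => ?_
  induction f using induction_coef_mul_word with
  | add f g hf hg => rw [map_add, map_add, hf, hg]
  | mono r w => rw [map_mul, map_mul, hc, hw]

/-- The value of a formal trace of a word under the substitution `σ` of words for variables. -/
def substCycle (σ : ℕ → FreeMonoid ℕ) (c : Cycle ℕ) : TraceRing F :=
  Quotient.liftOn c (fun l : List ℕ => wordTrace 0 (FreeMonoid.lift σ (FreeMonoid.ofList l))) (by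
    rintro l l' ⟨k, rfl⟩
    show wordTrace 0 _ = wordTrace 0 (FreeMonoid.lift σ (FreeMonoid.ofList (l.rotate k)))
    rw [List.rotate_eq_drop_append_take_mod, FreeMonoid.ofList_append, map_mul,
      wordTrace_mul_comm, ← map_mul, ← FreeMonoid.ofList_append, List.take_append_drop])

/-- The action on coefficients of the substitution of words for variables. -/
def substCoef (σ : ℕ → FreeMonoid ℕ) : TraceRing F →ₐ[F] TraceRing F :=
  MvPolynomial.aeval fun c : CyclicWord => substCycle σ c.1

/-- The substitution of words for variables. -/
def substWords (σ : ℕ → FreeMonoid ℕ) : FreeTraceAlgebra F →ₐ[F] FreeTraceAlgebra F :=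
  MonoidAlgebra.liftNCAlgHom
    (coef.comp (substCoef σ)) (word.comp (FreeMonoid.lift σ)) (fun _ _ => coef_commute _ _)

theorem substWords_coef_mul_word (σ : ℕ → FreeMonoid ℕ) (r : TraceRing F) (w : FreeMonoid ℕ) :
    substWords σ (coef r * word w) = coef (substCoef σ r) * word (FreeMonoid.lift σ w) := by
  rw [← single_eq_coef_mul_word]
  exact MonoidAlgebra.liftNC_single _ _ _ _

theorem substWords_coef (σ : ℕ → FreeMonoid ℕ) (r : TraceRing F) :
    substWords σ (coef r) = coef (substCoef σ r) := by
  simpa using substWords_coef_mul_word σ r 1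

theorem substWords_x (σ : ℕ → FreeMonoid ℕ) (i : ℕ) :
    substWords σ (x i : FreeTraceAlgebra F) = word (σ i) := by
  simpa using! substWords_coef_mul_word (F := F) σ 1 (FreeMonoid.of i)

theorem lift_ne_one {σ : ℕ → FreeMonoid ℕ} (hσ : ∀ i, σ i ≠ 1) {w : FreeMonoid ℕ} (hw : w ≠ 1) :
    FreeMonoid.lift σ w ≠ 1 := by
  induction w using FreeMonoid.inductionOn' with
  | one => exact absurd rfl hw
  | of_mul i w _ =>
    rw [map_mul, FreeMonoid.lift_eval_of]
    intro h
    have h' := congrArg FreeMonoid.toList h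
    rw [FreeMonoid.toList_mul, FreeMonoid.toList_one, List.append_eq_nil_iff] at h'
    exact hσ i (FreeMonoid.toList.injective h'.1)

/-- Nonempty images keep nonempty words nonempty, so Tr(1) never arises from another trace and δ may
be arbitrary, as `IsTraceTIdeal` demands. -/
theorem substCoef_wordTrace {σ : ℕ → FreeMonoid ℕ} (hσ : ∀ i, σ i ≠ 1) (δ : F)
    (w : FreeMonoid ℕ) :
    substCoef σ (wordTrace δ w) = wordTrace δ (FreeMonoid.lift σ w) := by
  by_cases hw : w = 1
  · subst hw
    rw [map_one, wordTrace_one, substCoef, MvPolynomial.aeval_C, MvPolynomial.algebraMap_eq]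
  · have h : w.toList ≠ [] := fun h => hw (FreeMonoid.toList.injective h)
    have h' : (FreeMonoid.lift σ w).toList ≠ [] :=
      fun h => lift_ne_one hσ hw (FreeMonoid.toList.injective h)
    rw [wordTrace, dif_neg h, substCoef, MvPolynomial.aeval_X, wordTrace, dif_neg h']
    show wordTrace 0 (FreeMonoid.lift σ w) = _
    rw [wordTrace, dif_neg h']

theorem substWords_commutesWithTr {σ : ℕ → FreeMonoid ℕ} (hσ : ∀ i, σ i ≠ 1) (δ : F) :
    CommutesWithTr δ (substWords σ) := by
  intro f
  induction f using induction_coef_mul_word with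
  | add f g hf hg => simp only [map_add, hf, hg]
  | mono r w =>
    rw [Tr_coef_mul_word, substWords_coef, substWords_coef_mul_word, Tr_coef_mul_word, map_mul,
      substCoef_wordTrace hσ]

end FreeTraceAlgebra

/-! ### Evaluations, and the closure properties of the ideal of identities -/

namespace AlgTrace

open FreeTraceAlgebra

variable {F A : Type*} [Field F] [Ring A] [Algebra F A]

theorem eval_coef_mul_word (t : AlgTrace F A) (a : ℕ → A) (r : TraceRing F) (w : FreeMonoid ℕ) :
    t.eval a (coef r * word w) =
      algebraMap F A (MvPolynomial.aeval (fun c : CyclicWord => t.cycleValue a c.1) r) *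
        FreeMonoid.lift a w := by
  rw [← single_eq_coef_mul_word]
  exact MonoidAlgebra.liftNC_single _ _ _ _

theorem eval_word (t : AlgTrace F A) (a : ℕ → A) (w : FreeMonoid ℕ) :
    t.eval a (word w) = FreeMonoid.lift a w := by
  simpa using t.eval_coef_mul_word a 1 w

theorem eval_x (t : AlgTrace F A) (a : ℕ → A) (i : ℕ) : t.eval a (x i) = a i := by
  simpa using! t.eval_word a (FreeMonoid.of i)

theorem eval_coef (t : AlgTrace F A) (a : ℕ → A) (r : TraceRing F) :
    t.eval a (coef r) =
      algebraMap F A (MvPolynomial.aeval (fun c : CyclicWord => t.cycleValue a c.1) r) := by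
  simpa using t.eval_coef_mul_word a r 1

/-- The normalisation Tr(1) = tr(1) is what makes the empty word fit. -/
theorem aeval_wordTrace (t : AlgTrace F A) (a : ℕ → A) (w : FreeMonoid ℕ) :
    MvPolynomial.aeval (fun c : CyclicWord => t.cycleValue a c.1) (wordTrace (t.toLin 1) w) =
      t.toLin (FreeMonoid.lift a w) := by
  by_cases h : w.toList = []
  · obtain rfl : w = 1 := FreeMonoid.toList.injective h
    rw [wordTrace_one, MvPolynomial.aeval_C, map_one (FreeMonoid.lift a)]; rfl
  · rw [wordTrace, dif_neg h, MvPolynomial.aeval_X, FreeMonoid.lift_apply]; rfl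

theorem eval_Tr (t : AlgTrace F A) (a : ℕ → A) (f : FreeTraceAlgebra F) :
    t.eval a (Tr (t.toLin 1) f) = algebraMap F A (t.toLin (t.eval a f)) := by
  induction f using induction_coef_mul_word with
  | add f g hf hg => simp only [map_add, hf, hg]
  | mono r w =>
    rw [Tr_coef_mul_word, eval_coef, map_mul, aeval_wordTrace, eval_coef_mul_word,
      ← Algebra.smul_def, map_smul, smul_eq_mul]

theorem eval_T (t : AlgTrace F A) (a : ℕ → A) (l : List ℕ) (h : l ≠ []) :
    t.eval a (T l h) = algebraMap F A (t.toLin (l.map a).prod) := by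
  rw [T_eq (t.toLin 1), eval_coef, aeval_wordTrace, FreeMonoid.lift_apply]; rfl

/-- Evaluating after a substitution is an evaluation. -/
theorem eval_comp (t : AlgTrace F A) (a : ℕ → A) {φ : FreeTraceAlgebra F →ₐ[F] FreeTraceAlgebra F}
    (hφ : CommutesWithTr (t.toLin 1) φ) :
    (t.eval a).comp φ = t.eval fun i => t.eval a (φ (x i)) := by
  have hw : ∀ w : FreeMonoid ℕ,
      t.eval a (φ (word w)) = FreeMonoid.lift (fun i => t.eval a (φ (x i))) w := by
    intro w
    induction w using FreeMonoid.inductionOn' with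
    | one => simp
    | of_mul i w ih =>
      rw [map_mul, map_mul, map_mul, map_mul, ih, FreeMonoid.lift_eval_of]; rfl
  apply algHom_ext_traces
  · intro i
    rw [eval_x]; rfl
  · intro l h
    rw [eval_T, AlgHom.comp_apply, T_eq (t.toLin 1), ← Tr_word, hφ, eval_Tr, hw,
      FreeMonoid.lift_apply]; rfl

/-- Evaluation carries Tr to tr, and evaluation after an endomorphism commuting with Tr is again an
evaluation. -/
theorem identities_isUnitalTraceTIdeal (t : AlgTrace F A) :
    IsUnitalTraceTIdeal (t.toLin 1) t.identities where
  tr_mem f hf := by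
    rw [mem_identities] at hf ⊢
    intro a
    rw [eval_Tr, hf, map_zero, map_zero]
  map_mem φ hφ f hf := by
    rw [mem_identities] at hf ⊢
    intro a
    rw [← AlgHom.comp_apply, eval_comp t a hφ, hf]

end AlgTrace

/-! ### Consequences of f₁ and g₃ in a trace T-ideal -/

namespace FreeTraceAlgebra

variable {F : Type*} [Field F]

/-- The trace of a list of variables, where the trace of the empty list is `δ`. -/
abbrev listTrace (δ : F) (l : List ℕ) : TraceRing F := wordTrace δ (FreeMonoid.ofList l)

theorem listTrace_append_comm (δ : F) (u v : List ℕ) :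
    listTrace δ (u ++ v) = listTrace δ (v ++ u) :=
  wordTrace_mul_comm δ (FreeMonoid.ofList u) (FreeMonoid.ofList v)

/-- The coefficients lying in a two-sided ideal. -/
def coefIdeal (I : TwoSidedIdeal (FreeTraceAlgebra F)) : Ideal (TraceRing F) :=
  Ideal.comap (coef : TraceRing F →ₐ[F] FreeTraceAlgebra F) I.asIdeal

theorem mem_coefIdeal {I : TwoSidedIdeal (FreeTraceAlgebra F)} {r : TraceRing F} :
    r ∈ coefIdeal I ↔ coef r ∈ I := by
  rw [coefIdeal, Ideal.mem_comap, TwoSidedIdeal.mem_asIdeal]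

/-- Moves g₃ into the commutative coefficient ring. Any δ will do, because g₃ contains traces of
nonempty words only. -/
theorem g₃_eq_coef (α δ : F) : g₃ α = coef
    (listTrace δ [0] * listTrace δ [1] * listTrace δ [2]
      + MvPolynomial.C (2 * α ^ 2) * listTrace δ [0, 1, 2]
      - MvPolynomial.C α * (listTrace δ [0] * listTrace δ [1, 2])
      - MvPolynomial.C α * (listTrace δ [1] * listTrace δ [0, 2])
      - MvPolynomial.C α * (listTrace δ [0, 1] * listTrace δ [2])) := by
  simp only [g₃, T_eq δ, map_add, map_sub, map_mul coef, coef_C, ← Algebra.smul_def]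

/-- The substitution `x₁ ↦ p`, `x₂ ↦ q`, and `x_i ↦ u` for all `i ≥ 3`. -/
def threeWords (p q u : List ℕ) : ℕ → FreeMonoid ℕ
  | 0 => FreeMonoid.ofList p
  | 1 => FreeMonoid.ofList q
  | _ => FreeMonoid.ofList u

theorem threeWords_ne_one {p q u : List ℕ} (hp : p ≠ []) (hq : q ≠ []) (hu : u ≠ []) (i : ℕ) :
    threeWords p q u i ≠ 1 := by
  match i with
  | 0 => exact hp
  | 1 => exact hq
  | _ + 2 => exact hu

namespace IsTraceTIdeal

variable {I : TwoSidedIdeal (FreeTraceAlgebra F)}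

theorem substWords_mem (hI : IsTraceTIdeal I) {f : FreeTraceAlgebra F} (hf : f ∈ I)
    {p q u : List ℕ} (hp : p ≠ []) (hq : q ≠ []) (hu : u ≠ []) :
    substWords (threeWords p q u) f ∈ I :=
  hI _ (substWords_commutesWithTr (threeWords_ne_one hp hq hu)) f hf

/-- Words commute modulo a trace `T`-ideal containing the commutator. -/
theorem word_sub_mem (hI : IsTraceTIdeal I) (hf : f₁ ∈ I) {l l' : List ℕ} (h : l.Perm l') :
    word (FreeMonoid.ofList l) - word (FreeMonoid.ofList l') ∈ I := by
  induction h with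
  | nil => simp
  | cons a _ ih =>
    rw [FreeMonoid.ofList_cons, FreeMonoid.ofList_cons, map_mul, map_mul, ← mul_sub]
    exact I.mul_mem_left _ _ ih
  | swap a b l =>
    -- f₁ does not involve x₃, so `u` is just some nonempty word.
    have h := hI.substWords_mem hf (p := [b]) (q := [a]) (u := [0]) (by simp) (by simp) (by simp)
    rw [f₁, map_sub, map_mul, map_mul, substWords_x, substWords_x] at h
    have h' := I.mul_mem_right _ (word (FreeMonoid.ofList l)) h
    simp only [FreeMonoid.ofList_cons, map_mul]
    convert h' using 1
    rw [sub_mul, mul_assoc, mul_assoc]; rfl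
  | trans _ _ h₁ h₂ => simpa using I.add_mem h₁ h₂

/-- The fundamental relation, for nonempty words. -/
theorem relation_of_ne_nil (hI : IsTraceTIdeal I) {α : F} (hg : g₃ α ∈ I) (δ : F)
    {p q u : List ℕ} (hp : p ≠ []) (hq : q ≠ []) (hu : u ≠ []) :
    listTrace δ p * listTrace δ q * listTrace δ u
      + MvPolynomial.C (2 * α ^ 2) * listTrace δ (p ++ q ++ u)
      - MvPolynomial.C α * (listTrace δ p * listTrace δ (q ++ u))
      - MvPolynomial.C α * (listTrace δ q * listTrace δ (p ++ u))
      - MvPolynomial.C α * (listTrace δ (p ++ q) * listTrace δ u) ∈ coefIdeal I := by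
  rw [mem_coefIdeal]
  convert hI.substWords_mem hg hp hq hu using 1
  rw [g₃_eq_coef α δ, substWords_coef]
  simp only [map_add, map_sub, map_mul, listTrace,
    substCoef_wordTrace (threeWords_ne_one hp hq hu), FreeMonoid.lift_ofList, List.map_cons,
    List.map_nil, List.prod_cons, List.prod_nil, mul_one, threeWords, FreeMonoid.ofList_append,
    mul_assoc]
  simp [substCoef]

/-- The fundamental relation for arbitrary words, with `Tr(1) = 2α`. -/
theorem relation (hI : IsTraceTIdeal I) {α : F} (hg : g₃ α ∈ I) (p q u : List ℕ) :
    listTrace (2 * α) p * listTrace (2 * α) q * listTrace (2 * α) u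
      + MvPolynomial.C (2 * α ^ 2) * listTrace (2 * α) (p ++ q ++ u)
      - MvPolynomial.C α * (listTrace (2 * α) p * listTrace (2 * α) (q ++ u))
      - MvPolynomial.C α * (listTrace (2 * α) q * listTrace (2 * α) (p ++ u))
      - MvPolynomial.C α * (listTrace (2 * α) (p ++ q) * listTrace (2 * α) u) ∈ coefIdeal I := by
  have h0 : listTrace (2 * α) [] = MvPolynomial.C (2 * α) := wordTrace_ofList_nil _
  -- When one of the words is empty, Tr(1) = 2α makes all terms cancel identically.
  by_cases hp : p = []
  · convert zero_mem (coefIdeal I)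
    simp only [hp, List.nil_append, h0, map_mul, map_pow, map_ofNat]
    ring
  by_cases hq : q = []
  · convert zero_mem (coefIdeal I)
    simp only [hq, List.nil_append, List.append_nil, h0, map_mul, map_pow, map_ofNat]
    ring
  by_cases hu : u = []
  · convert zero_mem (coefIdeal I)
    simp only [hu, List.append_nil, h0, map_mul, map_pow, map_ofNat]
    ring
  exact hI.relation_of_ne_nil hg _ hp hq hu

variable [CharZero F]

/-- All terms of g₃(a,b,l) except 2α²Tr(abl) are symmetric in a and b, so subtracting g₃(b,a,l)
isolates the difference. Commutation inside traces thus comes from g₃, without closing the ideal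
under Tr. -/
theorem listTrace_swap_sub_mem (hI : IsTraceTIdeal I) {α : F} (hα : α ≠ 0) (hg : g₃ α ∈ I) (δ : F)
    (a b : ℕ) (l : List ℕ) :
    listTrace δ (a :: b :: l) - listTrace δ (b :: a :: l) ∈ coefIdeal I := by
  by_cases hl : l = []
  · subst hl
    rw [show listTrace δ [a, b] = listTrace δ [b, a] from listTrace_append_comm δ [a] [b], sub_self]
    exact zero_mem _
  · have h₁ := hI.relation_of_ne_nil hg δ (p := [a]) (q := [b]) (by simp) (by simp) hl
    have h₂ := hI.relation_of_ne_nil hg δ (p := [b]) (q := [a]) (by simp) (by simp) hl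
    have h₃ := Ideal.mul_mem_left _ (MvPolynomial.C (2 * α ^ 2)⁻¹) (sub_mem h₁ h₂)
    have hc : (MvPolynomial.C (2 * α ^ 2)⁻¹ * MvPolynomial.C (2 * α ^ 2) : TraceRing F) = 1 := by
      rw [← map_mul, inv_mul_cancel₀ (by simp [hα]), map_one]
    convert h₃ using 1
    have hab : listTrace δ ([a] ++ [b]) = listTrace δ ([b] ++ [a]) := listTrace_append_comm δ [a] [b]
    rw [hab]
    simp only [List.cons_append, List.nil_append]
    linear_combination (listTrace δ (b :: a :: l) - listTrace δ (a :: b :: l)) * hc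

/-- Modulo the ideal, the trace of a word depends only on its letters. -/
theorem listTrace_sub_mem (hI : IsTraceTIdeal I) {α : F} (hα : α ≠ 0) (hg : g₃ α ∈ I) (δ : F)
    {l l' : List ℕ} (h : l.Perm l') : listTrace δ l - listTrace δ l' ∈ coefIdeal I := by
  -- The tail `w` lets the induction pass a leading letter around to the end by cyclicity.
  suffices H : ∀ w, listTrace δ (l ++ w) - listTrace δ (l' ++ w) ∈ coefIdeal I by simpa using H []
  induction h with
  | nil => intro w; rw [sub_self]; exact zero_mem _
  | @cons a l l' _ ih =>
    intro w
    have h := ih (w ++ [a])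
    rwa [← List.append_assoc, ← List.append_assoc, listTrace_append_comm δ (l ++ w),
      listTrace_append_comm δ (l' ++ w)] at h
  | swap a b l => intro w; exact hI.listTrace_swap_sub_mem hα hg δ _ _ _
  | trans _ _ h₁ h₂ => intro w; simpa using add_mem (h₁ w) (h₂ w)

end IsTraceTIdeal

end FreeTraceAlgebra

/-! ### The generic last entry and its inverse modulo the ideal -/

namespace FreeTraceAlgebra

open MvPolynomial

variable {F : Type*} [Field F]

/-- The letters carried by the `k`-th diagonal entry in a monomial of generic entries. -/
def entryLetters (k : Fin 3) : (Fin 3 × ℕ →₀ ℕ) →+ Multiset ℕ :=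
  Finsupp.weight fun y : Fin 3 × ℕ => if y.1 = k then {y.2} else (0 : Multiset ℕ)

/-- The exponent of the product of the `k`-th entries of the generic matrices in `u`. -/
def entryExponent (k : Fin 3) (u : Multiset ℕ) : Fin 3 × ℕ →₀ ℕ :=
  (u.map fun i => Finsupp.single (k, i) 1).sum

theorem entryLetters_single (k k' : Fin 3) (i : ℕ) :
    entryLetters k' (Finsupp.single (k, i) 1) = if k = k' then {i} else 0 := by
  simp [entryLetters, Finsupp.weight_single]

theorem entryExponent_add (k : Fin 3) (u v : Multiset ℕ) :
    entryExponent k (u + v) = entryExponent k u + entryExponent k v := by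
  simp [entryExponent]

theorem entryExponent_cons (k : Fin 3) (i : ℕ) (u : Multiset ℕ) :
    entryExponent k (i ::ₘ u) = Finsupp.single (k, i) 1 + entryExponent k u := by
  simp [entryExponent]

theorem entryExponent_zero (k : Fin 3) : entryExponent k 0 = 0 := by
  simp [entryExponent]

theorem entryExponent_singleton (k : Fin 3) (i : ℕ) :
    entryExponent k {i} = Finsupp.single (k, i) 1 := by
  simp [entryExponent]

theorem entryLetters_entryExponent (k k' : Fin 3) (u : Multiset ℕ) :
    entryLetters k' (entryExponent k u) = if k = k' then u else 0 := by
  induction u using Multiset.induction_on with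
  | empty => simp [entryExponent_zero]
  | cons i u ih =>
    rw [entryExponent_cons, map_add, ih, entryLetters_single]
    split_ifs <;> simp

theorem entryLetters_entryExponent_self (k : Fin 3) (u : Multiset ℕ) :
    entryLetters k (entryExponent k u) = u := by
  rw [entryLetters_entryExponent, if_pos rfl]

theorem entryLetters_entryExponent_of_ne {k k' : Fin 3} (h : k ≠ k') (u : Multiset ℕ) :
    entryLetters k' (entryExponent k u) = 0 := by
  rw [entryLetters_entryExponent, if_neg h]

theorem exponent_eq_sum_entryExponent (d : Fin 3 × ℕ →₀ ℕ) :
    d = entryExponent 0 (entryLetters 0 d) + entryExponent 1 (entryLetters 1 d)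
      + entryExponent 2 (entryLetters 2 d) := by
  induction d using Finsupp.induction_linear with
  | zero => simp [entryExponent_zero]
  | add d e hd he =>
    simp only [map_add, entryExponent_add]
    conv_lhs => rw [hd, he]
    abel
  | single y n =>
    induction n with
    | zero => simp [entryExponent_zero]
    | succ n ih =>
      rw [Finsupp.single_add]
      simp only [map_add, entryExponent_add]
      conv_lhs => rw [ih]
      obtain ⟨k, i⟩ := y
      simp only [entryLetters_single]
      fin_cases k <;> simp [entryExponent_zero, entryExponent_singleton] <;> abel

theorem prod_map_X_eq_monomial (k : Fin 3) (u : Multiset ℕ) :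
    (u.map fun i => (X (k, i) : MvPolynomial (Fin 3 × ℕ) F)).prod
      = monomial (entryExponent k u) 1 := by
  induction u using Multiset.induction_on with
  | empty => simp [entryExponent_zero]
  | cons i u ih =>
    rw [Multiset.map_cons, Multiset.prod_cons, ih, entryExponent_cons, X, monomial_mul, one_mul]

/-- The generic trace of a word with letters `u`: `α` times the sum of its first two entries. -/
def genericTrace (α : F) (u : Multiset ℕ) : MvPolynomial (Fin 3 × ℕ) F :=
  C α * ((u.map fun i => X (0, i)).prod + (u.map fun i => X (1, i)).prod)

/-- The last diagonal entry of a trace polynomial evaluated at generic diagonal matrices. -/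
def genericEntry (α : F) : FreeTraceAlgebra F →ₐ[F] MvPolynomial (Fin 3 × ℕ) F :=
  MonoidAlgebra.liftNCAlgHom (MvPolynomial.aeval fun c : CyclicWord => genericTrace α c.letters)
    (FreeMonoid.lift fun i => X (2, i)) (fun _ _ => Commute.all _ _)

theorem genericEntry_coef_mul_word (α : F) (r : TraceRing F) (w : FreeMonoid ℕ) :
    genericEntry α (coef r * word w) =
      MvPolynomial.aeval (fun c : CyclicWord => genericTrace α c.letters) r *
        FreeMonoid.lift (fun i => X (2, i)) w := by
  rw [← single_eq_coef_mul_word]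
  exact MonoidAlgebra.liftNC_single _ _ _ _

theorem genericEntry_word (α : F) (w : FreeMonoid ℕ) :
    genericEntry α (word w) = FreeMonoid.lift (fun i => X (2, i)) w := by
  simpa using genericEntry_coef_mul_word α 1 w

theorem genericEntry_x (α : F) (i : ℕ) : genericEntry α (x i) = X (2, i) := by
  simpa using! genericEntry_word α (FreeMonoid.of i)

theorem genericEntry_coef (α : F) (r : TraceRing F) :
    genericEntry α (coef r) =
      MvPolynomial.aeval (fun c : CyclicWord => genericTrace α c.letters) r := by
  simpa using genericEntry_coef_mul_word α r 1

theorem genericEntry_word_ofList (α : F) (l : List ℕ) :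
    genericEntry α (word (FreeMonoid.ofList l)) = monomial (entryExponent 2 l) 1 := by
  rw [genericEntry_word, FreeMonoid.lift_ofList, ← prod_map_X_eq_monomial, Multiset.map_coe,
    Multiset.prod_coe]

/-- For the empty word both sides are 2α, which is why this value of Tr(1) is used. -/
theorem aeval_listTrace (α : F) (l : List ℕ) :
    MvPolynomial.aeval (fun c : CyclicWord => genericTrace α c.letters) (listTrace (2 * α) l)
      = genericTrace α l := by
  by_cases h : l = []
  · subst h
    rw [listTrace, wordTrace_ofList_nil, aeval_C]
    simp [genericTrace, MvPolynomial.algebraMap_eq, map_ofNat C 2]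
    ring
  · rw [listTrace, wordTrace_of_ne _ _ h, aeval_X]
    rfl

theorem genericTrace_eq (α : F) (u : Multiset ℕ) :
    genericTrace α u
      = C α * (monomial (entryExponent 0 u) 1 + monomial (entryExponent 1 u) 1) := by
  rw [genericTrace, prod_map_X_eq_monomial, prod_map_X_eq_monomial]

/-- The symmetrised product of `p` at the first entry and `q` at the second entry, written with
traces. -/
def symmCoef (α : F) (p q : List ℕ) : TraceRing F :=
  C (2 * α ^ 2)⁻¹ * (listTrace (2 * α) p * listTrace (2 * α) q
    - C α * listTrace (2 * α) (p ++ q))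

/-- A trace polynomial whose generic last entry is the symmetrisation of a given monomial. -/
def monomialLift (α : F) (d : Fin 3 × ℕ →₀ ℕ) : FreeTraceAlgebra F :=
  coef (symmCoef α (entryLetters 0 d).toList (entryLetters 1 d).toList)
    * word (FreeMonoid.ofList (entryLetters 2 d).toList)

/-- The linear extension of `monomialLift`. -/
def polynomialLift (α : F) : MvPolynomial (Fin 3 × ℕ) F →ₗ[F] FreeTraceAlgebra F :=
  (basisMonomials (Fin 3 × ℕ) F).constr F (monomialLift α)

theorem polynomialLift_monomial (α : F) (d : Fin 3 × ℕ →₀ ℕ) :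
    polynomialLift α (monomial d 1) = monomialLift α d := by
  have h := (basisMonomials (Fin 3 × ℕ) F).constr_basis F (monomialLift α) d
  rwa [coe_basisMonomials] at h

/-- (2α)² - α·2α = 2α², which explains the normalising constant. -/
theorem symmCoef_nil [CharZero F] {α : F} (hα : α ≠ 0) : symmCoef α [] [] = 1 := by
  rw [symmCoef, List.append_nil, listTrace, wordTrace_ofList_nil, ← map_mul, ← map_mul, ← map_sub,
    ← map_mul, ← map_one C]
  congr 1
  field_simp
  ring

theorem coef_mul_mem {I : TwoSidedIdeal (FreeTraceAlgebra F)} {r : TraceRing F}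
    (hr : r ∈ coefIdeal I) (f : FreeTraceAlgebra F) :
    coef r * f ∈ I :=
  I.mul_mem_right _ _ (mem_coefIdeal.1 hr)

namespace IsTraceTIdeal

variable [CharZero F] {I : TwoSidedIdeal (FreeTraceAlgebra F)}

/-- Makes harmless the arbitrary order chosen by `Multiset.toList` in `monomialLift`. -/
theorem symmCoef_sub_mem (hI : IsTraceTIdeal I) {α : F} (hα : α ≠ 0) (hg : g₃ α ∈ I)
    {p p' q q' : List ℕ} (hp : p.Perm p') (hq : q.Perm q') :
    symmCoef α p q - symmCoef α p' q' ∈ coefIdeal I := by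
  have h₁ := hI.listTrace_sub_mem hα hg (2 * α) hp
  have h₂ := hI.listTrace_sub_mem hα hg (2 * α) hq
  have h₃ := hI.listTrace_sub_mem hα hg (2 * α) (hp.append hq)
  rw [← Ideal.Quotient.eq] at *
  simp only [symmCoef, map_mul, map_sub, h₁, h₂, h₃]

/-- Multiplication by a trace distributes over the first two entries. -/
theorem symmCoef_mul_listTrace (hI : IsTraceTIdeal I) {α : F} (hα : α ≠ 0) (hg : g₃ α ∈ I)
    (p q u : List ℕ) :
    C α * (symmCoef α (p ++ u) q + symmCoef α p (q ++ u)) - listTrace (2 * α) u * symmCoef α p q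
      ∈ coefIdeal I := by
  have h := hI.relation hg p q u
  have h' := hI.listTrace_sub_mem hα hg (2 * α)
    (show (p ++ u ++ q).Perm (p ++ q ++ u) by
      rw [List.append_assoc, List.append_assoc]; exact List.perm_append_comm.append_left p)
  rw [← Ideal.Quotient.eq_zero_iff_mem] at *
  rw [map_sub, sub_eq_zero] at h'
  simp only [symmCoef, map_mul, map_sub, map_add, h', ← List.append_assoc] at h ⊢
  have h2 : (Ideal.Quotient.mk (coefIdeal I)) (C 2) = 2 := by
    rw [map_ofNat C 2, map_ofNat]
  simp only [map_pow, h2] at h ⊢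
  -- Up to the factor -1/(2α²), the claim is the relation g₃(p,q,u).
  linear_combination (-(Ideal.Quotient.mk (coefIdeal I)) (C (2 * α ^ 2)⁻¹)) * h

/-- Multiplying a monomial by the generic trace of u adds the letters of u to entry 0 or to entry 1.
The lift of the result is α(S(pu,q) + S(p,qu)) times the word, so `symmCoef_mul_listTrace` applies.
-/
theorem polynomialLift_genericTrace_mul (hI : IsTraceTIdeal I) {α : F} (hα : α ≠ 0)
    (hg : g₃ α ∈ I) (u : List ℕ) (g : MvPolynomial (Fin 3 × ℕ) F) :
    polynomialLift α (genericTrace α u * g) - coef (listTrace (2 * α) u) * polynomialLift α g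
      ∈ I := by
  induction g using MvPolynomial.induction_on' with
  | add f g hf hg' =>
    rw [mul_add, map_add, map_add, mul_add, add_sub_add_comm]
    exact I.add_mem hf hg'
  | monomial d c =>
    have hc : (monomial d c : MvPolynomial (Fin 3 × ℕ) F) = c • monomial d 1 := by
      rw [smul_monomial, smul_eq_mul, mul_one]
    rw [hc, mul_smul_comm, map_smul, map_smul, mul_smul_comm, ← smul_sub, Algebra.smul_def]
    refine I.mul_mem_left _ _ ?_
    rw [genericTrace_eq, C_mul', smul_mul_assoc, add_mul, monomial_mul, monomial_mul, one_mul,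
      map_smul, map_add, polynomialLift_monomial, polynomialLift_monomial, polynomialLift_monomial]
    simp only [monomialLift, map_add, entryLetters_entryExponent_self, ne_eq, zero_ne_one,
      not_false_eq_true, entryLetters_entryExponent_of_ne, zero_add, one_ne_zero,
      show (0 : Fin 3) ≠ 2 by decide, show (1 : Fin 3) ≠ 2 by decide]
    set p := entryLetters 0 d
    set q := entryLetters 1 d
    have hp : (((u : Multiset ℕ) + p).toList).Perm (p.toList ++ u) := by
      rw [← Multiset.coe_eq_coe, ← Multiset.coe_add]; simp [add_comm]
    have hq : (((u : Multiset ℕ) + q).toList).Perm (q.toList ++ u) := by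
      rw [← Multiset.coe_eq_coe, ← Multiset.coe_add]; simp [add_comm]
    have h₁ := hI.symmCoef_sub_mem hα hg hp (List.Perm.refl q.toList)
    have h₂ := hI.symmCoef_sub_mem hα hg (List.Perm.refl p.toList) hq
    have h₃ := hI.symmCoef_mul_listTrace hα hg p.toList q.toList u
    have h₄ : C α * (symmCoef α ((u : Multiset ℕ) + p).toList q.toList
        + symmCoef α p.toList ((u : Multiset ℕ) + q).toList)
        - listTrace (2 * α) u * symmCoef α p.toList q.toList ∈ coefIdeal I := by
      rw [← Ideal.Quotient.eq] at *
      simp only [map_mul, map_add] at *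
      rw [h₁, h₂, h₃]
    convert coef_mul_mem h₄ (word (FreeMonoid.ofList (entryLetters 2 d).toList)) using 1
    rw [map_sub, map_mul, map_mul, map_add, coef_C, sub_mul, mul_assoc, mul_assoc, add_mul,
      ← Algebra.smul_def]

/-- Modulo the ideal, a trace polynomial is determined by its generic last entry. -/
theorem polynomialLift_genericEntry_sub_mem (hI : IsTraceTIdeal I) {α : F} (hα : α ≠ 0)
    (hf : f₁ ∈ I) (hg : g₃ α ∈ I) (f : FreeTraceAlgebra F) :
    polynomialLift α (genericEntry α f) - f ∈ I := by
  induction f using induction_coef_mul_word with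
  | add f g hf hg' =>
    rw [map_add, map_add, add_sub_add_comm]
    exact I.add_mem hf hg'
  | mono r w =>
    induction r using MvPolynomial.induction_on with
    | C c =>
      rw [coef_C, ← Algebra.smul_def, map_smul, map_smul, ← smul_sub, Algebra.smul_def]
      refine I.mul_mem_left _ _ ?_
      obtain ⟨l, rfl⟩ := FreeMonoid.ofList.surjective w
      rw [genericEntry_word_ofList, polynomialLift_monomial, monomialLift,
        entryLetters_entryExponent_of_ne (by decide), entryLetters_entryExponent_of_ne (by decide),
        entryLetters_entryExponent_self, Multiset.toList_zero, symmCoef_nil hα, map_one, one_mul]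
      apply hI.word_sub_mem hf
      rw [← Multiset.coe_eq_coe, Multiset.coe_toList]
    | add r s hr hs =>
      rw [map_add coef, add_mul, map_add, map_add, add_sub_add_comm]
      exact I.add_mem hr hs
    | mul_X r c hr =>
      obtain ⟨l, hl, rfl⟩ : ∃ l hl, c = CyclicWord.ofList l hl := by
        obtain ⟨c, hc⟩ := c
        induction c using Cycle.induction_on with
        | nil => exact absurd rfl hc
        | cons a l _ => exact ⟨a :: l, by simp, rfl⟩
      rw [← wordTrace_of_ne (2 * α), mul_comm r, map_mul coef, mul_assoc, map_mul (genericEntry α),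
        genericEntry_coef, aeval_listTrace]
      have h₁ := hI.polynomialLift_genericTrace_mul hα hg l (genericEntry α (coef r * word w))
      have h₂ := I.mul_mem_left (coef (listTrace (2 * α) l)) _ hr
      rw [mul_sub] at h₂
      simpa using I.add_mem h₁ h₂

theorem mem_of_genericEntry_eq_zero (hI : IsTraceTIdeal I) {α : F} (hα : α ≠ 0)
    (hf : f₁ ∈ I) (hg : g₃ α ∈ I) {f : FreeTraceAlgebra F} (h : genericEntry α f = 0) : f ∈ I := by
  simpa [h] using hI.polynomialLift_genericEntry_sub_mem hα hf hg f

end IsTraceTIdeal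

/-! ### Identities of the diagonal algebra in terms of the generic last entry -/

/-- The `k`-th diagonal entry, as an algebra homomorphism. -/
def diagEntry {n : ℕ} (k : Fin n) : DiagAlg F n →ₐ[F] F where
  toFun a := (a : Matrix (Fin n) (Fin n) F) k k
  map_one' := by simp
  map_mul' := by
    rintro ⟨_, u, rfl⟩ ⟨_, v, rfl⟩
    simp
  map_zero' := by simp
  map_add' := by simp
  commutes' c := by
    rw [Subalgebra.coe_algebraMap, Matrix.algebraMap_matrix_apply, if_pos rfl,
      Algebra.algebraMap_self_apply]

theorem diagTrace_toLin (α : F) (a : DiagAlg F 3) :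
    (diagTrace ![α, α, 0]).toLin a = α * (diagEntry 0 a + diagEntry 1 a) := by
  simp [diagTrace, diagEntry, Fin.sum_univ_three, mul_add]
  rfl

theorem diagTrace_toLin_one (α : F) : (diagTrace ![α, α, 0]).toLin 1 = 2 * α := by
  rw [diagTrace_toLin, map_one, map_one]; ring

theorem diagAlg_mul_comm {n : ℕ} (a b : DiagAlg F n) : a * b = b * a := by
  obtain ⟨_, u, rfl⟩ := a
  obtain ⟨_, v, rfl⟩ := b
  apply Subtype.ext
  simp [mul_comm]

/-- The diagonal matrix with given entries. -/
def diagOf (y : Fin 3 → F) : DiagAlg F 3 :=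
  ⟨Matrix.diagonalAlgHom F y, y, rfl⟩

theorem diagEntry_diagOf (y : Fin 3 → F) (k : Fin 3) : diagEntry k (diagOf y) = y k := by
  show Matrix.diagonal y k k = y k
  simp

/-- Both sides are algebra homomorphisms in `f`, so variables and traces of words suffice. -/
theorem aeval_genericEntry (α : F) (y : Fin 3 × ℕ → F) (f : FreeTraceAlgebra F) :
    MvPolynomial.aeval y (genericEntry α f) =
      diagEntry 2 ((diagTrace ![α, α, 0]).eval (fun i => diagOf fun k => y (k, i)) f) := by
  have h : (MvPolynomial.aeval y).comp (genericEntry α) =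
      (diagEntry 2).comp ((diagTrace ![α, α, 0]).eval fun i => diagOf fun k => y (k, i)) := by
    apply algHom_ext_traces
    · intro i
      rw [AlgHom.comp_apply, AlgHom.comp_apply, AlgTrace.eval_x, genericEntry_x, aeval_X,
        diagEntry_diagOf]
    · intro l h
      rw [AlgHom.comp_apply, AlgHom.comp_apply, AlgTrace.eval_T, AlgHom.commutes,
        T_eq (2 * α), genericEntry_coef, aeval_listTrace, diagTrace_toLin, map_list_prod,
        map_list_prod, List.map_map, List.map_map]
      simp [genericTrace, map_list_prod, Function.comp_def, diagEntry_diagOf]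
  exact DFunLike.congr_fun h f

/-- A polynomial vanishing at all points of an infinite field is zero. -/
theorem genericEntry_eq_zero_of_mem_identities [CharZero F] {α : F} {f : FreeTraceAlgebra F}
    (hf : f ∈ (diagTrace ![α, α, 0]).identities) : genericEntry α f = 0 := by
  rw [AlgTrace.mem_identities] at hf
  apply MvPolynomial.funext
  intro y
  rw [← MvPolynomial.coe_aeval_eq_eval, RingHom.coe_coe, aeval_genericEntry, hf, map_zero, map_zero]

theorem f₁_mem_identities {n : ℕ} (α : Fin n → F) : f₁ ∈ (diagTrace α).identities := by
  rw [AlgTrace.mem_identities]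
  intro a
  rw [f₁, map_sub, map_mul, map_mul, diagAlg_mul_comm, sub_self]

/-- With t = Tr/α, g₃ is α³ times the alternating sum over S₃ of products of t along cycles, the two
3-cycles being merged by commutativity. It vanishes since t is a sum of two characters. -/
theorem g₃_mem_identities (α : F) : g₃ α ∈ (diagTrace ![α, α, 0]).identities := by
  rw [AlgTrace.mem_identities]
  intro a
  simp only [g₃, map_add, map_sub, map_mul, map_smul, AlgTrace.eval_T]
  simp only [diagTrace_toLin, List.map_cons, List.map_nil, List.prod_cons, List.prod_nil, mul_one,
    map_mul (diagEntry _), ← map_mul (algebraMap F (DiagAlg F 3)), Algebra.smul_def,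
    ← map_add (algebraMap F (DiagAlg F 3)), ← map_sub (algebraMap F (DiagAlg F 3))]
  rw [← map_zero (algebraMap F (DiagAlg F 3))]
  congr 1
  ring

theorem IsUnitalTraceTIdeal.isTraceTIdeal {δ : F} {I : TwoSidedIdeal (FreeTraceAlgebra F)}
    (hI : IsUnitalTraceTIdeal δ I) : IsTraceTIdeal I :=
  fun φ hφ => hI.map_mem φ (hφ δ)

theorem diagTrace_identities_isUnitalTraceTIdeal (α : F) :
    IsUnitalTraceTIdeal (2 * α) (diagTrace ![α, α, 0]).identities := by
  rw [← diagTrace_toLin_one]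
  exact AlgTrace.identities_isUnitalTraceTIdeal _

/-- The other two entries need no inspection: the identities themselves form a trace T-ideal
containing f₁ and g₃, so a vanishing last entry suffices. -/
theorem mem_identities_iff_genericEntry [CharZero F] {α : F} (hα : α ≠ 0)
    {f : FreeTraceAlgebra F} :
    f ∈ (diagTrace ![α, α, 0]).identities ↔ genericEntry α f = 0 :=
  ⟨genericEntry_eq_zero_of_mem_identities,
    (diagTrace_identities_isUnitalTraceTIdeal α).isTraceTIdeal.mem_of_genericEntry_eq_zero hα
      (f₁_mem_identities _) (g₃_mem_identities α)⟩

/-- The only mismatch is α²Tr(x₁x₂x₃) + α²Tr(x₂x₁x₃) against 2α²Tr(x₁x₂x₃). -/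
theorem Tr_f₃_mul_x (α δ : F) :
    Tr δ (f₃ α * x 2) = g₃ α - α ^ 2 • Tr δ (f₁ * x 2) := by
  have hx : ∀ i j k : ℕ, Tr δ (x i * x j * x k : FreeTraceAlgebra F) = T [i, j, k] := by
    intro i j k
    rw [x_eq_word, x_eq_word, x_eq_word, ← map_mul, ← map_mul, Tr_word, T_eq δ]; rfl
  have hx₂ : ∀ i j : ℕ, Tr δ (x i * x j : FreeTraceAlgebra F) = T [i, j] := by
    intro i j
    rw [x_eq_word, x_eq_word, ← map_mul, Tr_word, T_eq δ]; rfl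
  have hx₁ : ∀ i : ℕ, Tr δ (x i : FreeTraceAlgebra F) = T [i] := by
    intro i
    rw [x_eq_word, Tr_word, T_eq δ]; rfl
  have hT : ∀ l h f, Tr δ (T l h * f : FreeTraceAlgebra F) = T l h * Tr δ f := by
    intro l h f
    rw [T_eq δ, Tr_coef_mul]
  have hs : ∀ (c : F) (f : FreeTraceAlgebra F), Tr δ (c • f) = c • Tr δ f := by
    intro c f
    rw [Algebra.smul_def, ← coef_C, Tr_coef_mul, coef_C, ← Algebra.smul_def]
  simp only [f₃, f₁, g₃, add_mul, sub_mul, smul_mul_assoc, mul_assoc (T _ _), map_add, map_sub,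
    hs, hT, hx, hx₂, hx₁]
  module

/-- Modulo the commutator, `g₃` is `Tr(f₃ x₃)`. -/
theorem g₃_sub_Tr_f₃_mul_x_mem {δ : F} (α : F) {I : TwoSidedIdeal (FreeTraceAlgebra F)}
    (hI : IsUnitalTraceTIdeal δ I) (hf : f₁ ∈ I) : g₃ α - Tr δ (f₃ α * x 2) ∈ I := by
  rw [Tr_f₃_mul_x, sub_sub_cancel, Algebra.smul_def]
  exact I.mul_mem_left _ _ (hI.tr_mem _ (I.mul_mem_right _ _ hf))

theorem identities_isLeast_traceTIdeal [CharZero F] {α : F} (hα : α ≠ 0) :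
    IsLeast {I : TwoSidedIdeal (FreeTraceAlgebra F) | IsTraceTIdeal I ∧ f₁ ∈ I ∧ g₃ α ∈ I}
      (diagTrace ![α, α, 0]).identities :=
  ⟨⟨(diagTrace_identities_isUnitalTraceTIdeal α).isTraceTIdeal, f₁_mem_identities _,
    g₃_mem_identities α⟩, fun _ ⟨hI, hf, hg⟩ _ h =>
      hI.mem_of_genericEntry_eq_zero hα hf hg (genericEntry_eq_zero_of_mem_identities h)⟩

/-- The stronger closure property only shrinks the class of ideals, and the identities still belong
to it. -/
theorem identities_isLeast_unitalTraceTIdeal [CharZero F] {α : F} (hα : α ≠ 0) :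
    IsLeast {I : TwoSidedIdeal (FreeTraceAlgebra F) |
        IsUnitalTraceTIdeal (2 * α) I ∧ f₁ ∈ I ∧ g₃ α ∈ I}
      (diagTrace ![α, α, 0]).identities :=
  ⟨⟨diagTrace_identities_isUnitalTraceTIdeal α, f₁_mem_identities _, g₃_mem_identities α⟩,
    fun _ ⟨hI, hf, hg⟩ => (identities_isLeast_traceTIdeal hα).2 ⟨hI.isTraceTIdeal, hf, hg⟩⟩

end FreeTraceAlgebra

/-! ### Dimension of the functions invariant under an involution -/

theorem quotientDim_eq_finrank_range {F V W : Type*} [Field F] [AddCommGroup V] [Module F V]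
    [AddCommGroup W] [Module F W] {M N : Submodule F V} (L : V →ₗ[F] W)
    (h : N.comap M.subtype = LinearMap.ker (L.domRestrict M)) :
    quotientDim M N = Module.finrank F (LinearMap.range (L.domRestrict M)) := by
  rw [quotientDim, h]
  exact (LinearMap.quotKerEquivRange (L.domRestrict M)).finrank_eq

/-- The functions invariant under a permutation of their domain. -/
def invariantFunctions (F : Type*) [Field F] {ι : Type*} (σ : Equiv.Perm ι) :
    Submodule F (ι → F) :=
  LinearMap.eqLocus (LinearMap.funLeft F F σ) LinearMap.id

theorem mem_invariantFunctions {F : Type*} [Field F] {ι : Type*} {σ : Equiv.Perm ι} {v : ι → F} :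
    v ∈ invariantFunctions F σ ↔ ∀ i, v (σ i) = v i := by
  rw [invariantFunctions, LinearMap.mem_eqLocus, funext_iff]; rfl

/-- The space of functions invariant under an involution, by the trace of a projection onto it. -/
theorem two_mul_finrank_invariantFunctions (F : Type*) [Field F] [CharZero F] {ι : Type*} [Fintype ι]
    [DecidableEq ι] {σ : Equiv.Perm ι} (hσ : ∀ i, σ (σ i) = i) :
    2 * Module.finrank F (invariantFunctions F σ) =
      Fintype.card ι + (Finset.univ.filter fun i => σ i = i).card := by
  set P : (ι → F) →ₗ[F] (ι → F) := (2⁻¹ : F) • (LinearMap.id + LinearMap.funLeft F F σ) with hP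
  have hproj : LinearMap.IsProj (invariantFunctions F σ) P := by
    constructor
    · intro v
      rw [mem_invariantFunctions]
      intro i
      simp [P, LinearMap.funLeft, hσ, add_comm]
    · intro v hv
      rw [mem_invariantFunctions] at hv
      ext i
      simp [P, LinearMap.funLeft, hv]
      ring
  have htr := hproj.trace
  -- The trace of a permutation matrix counts fixed points.
  have hfun : LinearMap.trace F (ι → F) (LinearMap.funLeft F F σ) =
      ((Finset.univ.filter fun i => σ i = i).card : F) := by
    rw [LinearMap.trace_eq_matrix_trace F (Pi.basisFun F ι), Matrix.trace, Finset.card_filter]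
    push_cast
    refine Finset.sum_congr rfl fun i _ => ?_
    simp [LinearMap.funLeft, Pi.single_apply]
  rw [hP, map_smul, map_add, hfun, LinearMap.trace_id, Module.finrank_fintype_fun_eq_card,
    smul_eq_mul] at htr
  have h2 : (2 : F) ≠ 0 := two_ne_zero
  apply Nat.cast_injective (R := F)
  push_cast
  rw [← htr]
  field_simp

/-! ### Multilinear coefficients and the codimension -/

namespace FreeTraceAlgebra

open MvPolynomial

variable {F : Type*} [Field F]

/-- All the letters of a monomial of generic entries. -/
def allLetters : (Fin 3 × ℕ →₀ ℕ) →+ Multiset ℕ :=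
  Finsupp.weight fun y : Fin 3 × ℕ => ({y.2} : Multiset ℕ)

theorem allLetters_single (y : Fin 3 × ℕ) (n : ℕ) :
    allLetters (Finsupp.single y n) = n • {y.2} := by
  simp [allLetters, Finsupp.weight_single]

theorem allLetters_eq_map_toMultiset (d : Fin 3 × ℕ →₀ ℕ) :
    allLetters d = (Finsupp.toMultiset d).map Prod.snd := by
  induction d using Finsupp.induction_linear with
  | zero => simp
  | add d e hd he => simp [hd, he]
  | single y n => simp [allLetters_single, Multiset.map_nsmul]

theorem allLetters_eq_sum_entryLetters (d : Fin 3 × ℕ →₀ ℕ) :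
    allLetters d = entryLetters 0 d + entryLetters 1 d + entryLetters 2 d := by
  induction d using Finsupp.induction_linear with
  | zero => simp
  | add d e hd he => rw [map_add, map_add, map_add, map_add, hd, he]; abel
  | single y n =>
    obtain ⟨k, i⟩ := y
    simp only [allLetters_single, entryLetters, Finsupp.weight_single]
    fin_cases k <;> simp

/-- The exponent of the multilinear monomial taking the `g i`-th entry of the `i`-th matrix. -/
def multilinearExponent {n : ℕ} (g : Fin n → Fin 3) : Fin 3 × ℕ →₀ ℕ :=
  ∑ i, Finsupp.single (g i, (i : ℕ)) 1

theorem multilinearExponent_apply {n : ℕ} (g : Fin n → Fin 3) (k : Fin 3) (i : Fin n) :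
    multilinearExponent g (k, i) = if g i = k then 1 else 0 := by
  rw [multilinearExponent, Finsupp.finsetSum_apply, Finset.sum_eq_single i]
  · simp [Finsupp.single_apply]
  · intro j _ hj
    rw [Finsupp.single_apply, if_neg]
    simpa [Fin.ext_iff] using fun _ => Fin.val_ne_of_ne hj
  · simp

theorem multilinearExponent_injective {n : ℕ} :
    Function.Injective (multilinearExponent : (Fin n → Fin 3) → _) := by
  intro g h hgh
  ext1 i
  have := multilinearExponent_apply h (g i) i
  rw [← hgh, multilinearExponent_apply, if_pos rfl] at this
  by_contra hne
  rw [if_neg (Ne.symm hne)] at this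
  exact one_ne_zero this

theorem allLetters_multilinearExponent {n : ℕ} (g : Fin n → Fin 3) :
    allLetters (multilinearExponent g) = Multiset.range n := by
  rw [multilinearExponent, map_sum]
  simp only [allLetters_single, one_smul]
  rw [Fin.sum_univ_eq_sum_range (fun i => ({i} : Multiset ℕ)) n, Finset.sum_multiset_singleton,
    Finset.range_val]

/-- Peel off the unique factor carrying the largest letter. Taking `g` on all of ℕ lets the
induction update a single value. -/
theorem exists_sum_of_allLetters_eq_range {n : ℕ} {d : Fin 3 × ℕ →₀ ℕ}
    (hd : allLetters d = Multiset.range n) :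
    ∃ g : ℕ → Fin 3, d = ∑ i ∈ Finset.range n, Finsupp.single (g i, i) 1 := by
  induction n generalizing d with
  | zero =>
    refine ⟨0, ?_⟩
    rw [allLetters_eq_map_toMultiset, Multiset.range_zero, Multiset.map_eq_zero] at hd
    simpa using congrArg Multiset.toFinsupp hd
  | succ n ih =>
    have hn : n ∈ allLetters d := by rw [hd]; simp
    rw [allLetters_eq_map_toMultiset, Multiset.mem_map] at hn
    obtain ⟨⟨k, m⟩, hy, rfl⟩ := hn
    rw [Finsupp.mem_toMultiset, Finsupp.mem_support_iff] at hy
    have hle : Finsupp.single (k, m) 1 ≤ d := by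
      rw [Finsupp.single_le_iff]; omega
    obtain ⟨e, rfl⟩ := exists_add_of_le hle
    rw [map_add, allLetters_single, one_smul, Multiset.range_succ, ← Multiset.singleton_add] at hd
    obtain ⟨g, rfl⟩ := ih (add_left_cancel hd)
    refine ⟨Function.update g m k, ?_⟩
    rw [Finset.sum_range_succ, add_comm, Function.update_self]
    congr 1
    refine Finset.sum_congr rfl fun i hi => ?_
    rw [Function.update_of_ne (Finset.mem_range.1 hi).ne]

theorem exists_multilinearExponent {n : ℕ} {d : Fin 3 × ℕ →₀ ℕ}
    (hd : allLetters d = Multiset.range n) : ∃ g : Fin n → Fin 3, multilinearExponent g = d := by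
  obtain ⟨g, rfl⟩ := exists_sum_of_allLetters_eq_range hd
  exact ⟨fun i => g i, (Finset.sum_range fun i => Finsupp.single (g i, i) 1).symm⟩

/-- The exchange of the first two entries. -/
def swapEntries : Equiv.Perm (Fin 3 × ℕ) := (Equiv.swap 0 1).prodCongr (Equiv.refl ℕ)

/-- The exchange of the values `0` and `1` of a function. -/
def swapValues (n : ℕ) : Equiv.Perm (Fin n → Fin 3) :=
  (Equiv.refl (Fin n)).arrowCongr (Equiv.swap 0 1)

theorem swapValues_apply {n : ℕ} (g : Fin n → Fin 3) (i : Fin n) :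
    swapValues n g i = Equiv.swap 0 1 (g i) := rfl

theorem swapValues_swapValues {n : ℕ} (g : Fin n → Fin 3) : swapValues n (swapValues n g) = g := by
  ext1 i
  rw [swapValues_apply, swapValues_apply, Equiv.swap_apply_self]

theorem mapDomain_multilinearExponent {n : ℕ} (g : Fin n → Fin 3) :
    Finsupp.mapDomain swapEntries (multilinearExponent g) =
      multilinearExponent (swapValues n g) := by
  rw [multilinearExponent, Finsupp.mapDomain_finsetSum]
  simp only [Finsupp.mapDomain_single]
  rfl

/-- Entries 0 and 1 enter only through traces, where they have equal weight α. -/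
theorem rename_swapEntries_genericEntry (α : F) (f : FreeTraceAlgebra F) :
    rename swapEntries (genericEntry α f) = genericEntry α f := by
  have h : (rename swapEntries).comp (genericEntry α) = genericEntry α := by
    apply algHom_ext_traces
    · intro i
      rw [AlgHom.comp_apply, genericEntry_x, rename_X]
      rfl
    · intro l h
      have h₀ : ∀ i, swapEntries (0, i) = (1, i) := fun _ => rfl
      have h₁ : ∀ i, swapEntries (1, i) = (0, i) := fun _ => rfl
      rw [AlgHom.comp_apply, T_eq (2 * α), genericEntry_coef, aeval_listTrace]
      simp [genericTrace, map_list_prod, Function.comp_def, h₀, h₁, add_comm]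
  exact DFunLike.congr_fun h f

/-- Weights in `Multiset ℕ` record the multidegree, so weight `Multiset.range n` means multilinear
in the first n matrices. -/
theorem genericTrace_isWeightedHomogeneous (α : F) (u : Multiset ℕ) :
    IsWeightedHomogeneous (fun y : Fin 3 × ℕ => ({y.2} : Multiset ℕ)) (genericTrace α u) u := by
  have h : ∀ k : Fin 3, IsWeightedHomogeneous (fun y : Fin 3 × ℕ => ({y.2} : Multiset ℕ))
      (u.map fun i => (X (k, i) : MvPolynomial (Fin 3 × ℕ) F)).prod u := by
    intro k
    induction u using Multiset.induction_on with
    | empty => simpa using isWeightedHomogeneous_one F _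
    | cons i u ih =>
      rw [Multiset.map_cons, Multiset.prod_cons, ← Multiset.singleton_add]
      exact (isWeightedHomogeneous_X F _ (k, i)).mul ih
  simpa [genericTrace] using (isWeightedHomogeneous_C _ α).mul ((h 0).add (h 1))

theorem genericEntry_isWeightedHomogeneous (α : F) {n : ℕ} {f : FreeTraceAlgebra F}
    (hf : f ∈ MT F n) :
    IsWeightedHomogeneous (fun y : Fin 3 × ℕ => ({y.2} : Multiset ℕ)) (genericEntry α f)
      (Multiset.range n) := by
  rw [← mem_weightedHomogeneousSubmodule]
  induction hf using Submodule.span_induction with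
  | zero => rw [map_zero]; exact zero_mem _
  | add f g _ _ hf hg => rw [map_add]; exact add_mem hf hg
  | smul c f _ hf => rw [map_smul]; exact Submodule.smul_mem _ c hf
  | mem f hf =>
    obtain ⟨s, w, hs, rfl⟩ := hf
    rw [mem_weightedHomogeneousSubmodule, single_eq_coef_mul_word, genericEntry_coef_mul_word, ← hs]
    refine IsWeightedHomogeneous.mul ?_ ?_
    · clear hs
      induction s using Multiset.induction_on with
      | empty => simpa using isWeightedHomogeneous_one F _
      | cons c s ih =>
        rw [Multiset.map_cons, Multiset.prod_cons, Multiset.map_cons, Multiset.sum_cons, map_mul,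
          aeval_X]
        exact (genericTrace_isWeightedHomogeneous α _).mul ih
    · clear hs
      induction w using FreeMonoid.inductionOn' with
      | one => simpa using isWeightedHomogeneous_one F _
      | of_mul i w ih =>
        rw [map_mul, FreeMonoid.lift_eval_of, FreeMonoid.toList_of_mul, ← Multiset.cons_coe,
          ← Multiset.singleton_add]
        exact (isWeightedHomogeneous_X F _ (2, i)).mul ih

/-- Treats the empty word, whose trace is a scalar, uniformly with the others. -/
theorem listTrace_eq_prod (δ : F) (p : List ℕ) : ∃ (c : F) (s : Multiset CyclicWord),
    listTrace δ p = C c * (s.map X).prod ∧ (s.map CyclicWord.letters).sum = p := by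
  by_cases h : p = []
  · subst h
    exact ⟨δ, 0, by simp [listTrace, wordTrace_one], by simp⟩
  · refine ⟨1, {CyclicWord.ofList p h}, by simp [listTrace, wordTrace_of_ne _ _ h], ?_⟩
    rw [Multiset.map_singleton, Multiset.sum_singleton]
    rfl

theorem smul_mem_MT {n : ℕ} (c : F) (s : Multiset CyclicWord) (l : List ℕ)
    (h : (s.map CyclicWord.letters).sum + (l : Multiset ℕ) = Multiset.range n) :
    coef (C c * (s.map X).prod) * word (FreeMonoid.ofList l) ∈ MT F n := by
  rw [map_mul, coef_C, mul_assoc, ← Algebra.smul_def, ← single_eq_coef_mul_word]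
  exact Submodule.smul_mem _ _ (Submodule.subset_span ⟨s, _, h, rfl⟩)

theorem coef_symmCoef_mul_word_mem_MT {n : ℕ} (α : F) {p q l : List ℕ}
    (h : (p : Multiset ℕ) + q + l = Multiset.range n) :
    coef (symmCoef α p q) * word (FreeMonoid.ofList l) ∈ MT F n := by
  obtain ⟨c, s, hs, hs'⟩ := listTrace_eq_prod (2 * α) p
  obtain ⟨c', s', ht, ht'⟩ := listTrace_eq_prod (2 * α) q
  obtain ⟨c'', s'', hu, hu'⟩ := listTrace_eq_prod (2 * α) (p ++ q)
  have h₁ : symmCoef α p q = C ((2 * α ^ 2)⁻¹ * (c * c')) * ((s + s').map X).prod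
      - C ((2 * α ^ 2)⁻¹ * (α * c'')) * (s''.map X).prod := by
    rw [symmCoef, hs, ht, hu]
    simp only [map_mul, Multiset.map_add, Multiset.prod_add]
    ring
  rw [h₁, map_sub, sub_mul]
  refine sub_mem (smul_mem_MT _ _ _ ?_) (smul_mem_MT _ _ _ ?_)
  · rw [Multiset.map_add, Multiset.sum_add, hs', ht', h]
  · rw [hu', ← Multiset.coe_add, h]

theorem monomialLift_mem_MT {n : ℕ} (α : F) {d : Fin 3 × ℕ →₀ ℕ}
    (hd : allLetters d = Multiset.range n) : monomialLift α d ∈ MT F n := by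
  apply coef_symmCoef_mul_word_mem_MT
  rw [Multiset.coe_toList, Multiset.coe_toList, Multiset.coe_toList,
    ← allLetters_eq_sum_entryLetters, hd]

/-- Subtracting αTr(pq) removes from Tr(p)Tr(q) the terms with p and q at the same entry; only the
two cross terms survive. -/
theorem aeval_symmCoef [CharZero F] {α : F} (hα : α ≠ 0) (p q : List ℕ) :
    MvPolynomial.aeval (fun c : CyclicWord => genericTrace α c.letters) (symmCoef α p q) =
      C 2⁻¹ * (monomial (entryExponent 0 p + entryExponent 1 q) 1
        + monomial (entryExponent 1 p + entryExponent 0 q) 1) := by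
  rw [symmCoef, map_mul, map_sub, map_mul, map_mul, aeval_listTrace, aeval_listTrace,
    aeval_listTrace, aeval_C, aeval_C, MvPolynomial.algebraMap_eq, genericTrace_eq, genericTrace_eq,
    genericTrace_eq, ← Multiset.coe_add, entryExponent_add, entryExponent_add,
    show (2⁻¹ : F) = (2 * α ^ 2)⁻¹ * α ^ 2 by field_simp]
  have hm : ∀ d e : Fin 3 × ℕ →₀ ℕ,
      (monomial (d + e) 1 : MvPolynomial (Fin 3 × ℕ) F) = monomial d 1 * monomial e 1 := by
    intro d e
    rw [monomial_mul, one_mul]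
  simp only [hm, map_mul, map_pow]
  ring

theorem mapDomain_swapEntries_entryExponent (k : Fin 3) (u : Multiset ℕ) :
    Finsupp.mapDomain swapEntries (entryExponent k u) = entryExponent (Equiv.swap 0 1 k) u := by
  induction u using Multiset.induction_on with
  | empty => simp [entryExponent_zero]
  | cons i u ih =>
    rw [entryExponent_cons, entryExponent_cons, Finsupp.mapDomain_add, ih, Finsupp.mapDomain_single]
    rfl

/-- The generic last entry of `monomialLift` is the symmetrisation of the monomial. -/
theorem genericEntry_monomialLift [CharZero F] {α : F} (hα : α ≠ 0) (d : Fin 3 × ℕ →₀ ℕ) :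
    genericEntry α (monomialLift α d) =
      (2⁻¹ : F) • (monomial d 1 + monomial (Finsupp.mapDomain swapEntries d) 1) := by
  rw [monomialLift, map_mul, genericEntry_coef, genericEntry_word_ofList, aeval_symmCoef hα,
    Multiset.coe_toList, Multiset.coe_toList, Multiset.coe_toList, C_mul', smul_mul_assoc, add_mul,
    monomial_mul, monomial_mul, one_mul, ← exponent_eq_sum_entryExponent]
  conv_rhs => rw [exponent_eq_sum_entryExponent d]
  rw [Finsupp.mapDomain_add, Finsupp.mapDomain_add, mapDomain_swapEntries_entryExponent,
    mapDomain_swapEntries_entryExponent, mapDomain_swapEntries_entryExponent,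
    ← exponent_eq_sum_entryExponent]
  rfl

/-- The multilinear coefficients of a polynomial in the generic entries. -/
def multilinearCoeffs (F : Type*) [Field F] (n : ℕ) :
    MvPolynomial (Fin 3 × ℕ) F →ₗ[F] ((Fin n → Fin 3) → F) :=
  LinearMap.pi fun g => lcoeff F (multilinearExponent g)

/-- The multilinear coefficients of the generic last entry of a trace polynomial. -/
def entryCoeffs (α : F) (n : ℕ) : FreeTraceAlgebra F →ₗ[F] ((Fin n → Fin 3) → F) :=
  multilinearCoeffs F n ∘ₗ (genericEntry α).toLinearMap

theorem entryCoeffs_apply (α : F) {n : ℕ} (f : FreeTraceAlgebra F) (g : Fin n → Fin 3) :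
    entryCoeffs α n f g = coeff (multilinearExponent g) (genericEntry α f) := rfl

/-- By homogeneity only multilinear monomials can occur. -/
theorem genericEntry_eq_zero_of_entryCoeffs (α : F) {n : ℕ} {f : FreeTraceAlgebra F}
    (hf : f ∈ MT F n) (h : entryCoeffs α n f = 0) : genericEntry α f = 0 := by
  ext d
  rw [coeff_zero]
  by_contra hd
  obtain ⟨g, rfl⟩ := exists_multilinearExponent (genericEntry_isWeightedHomogeneous α hf hd)
  exact hd (congrFun h g)

theorem entryCoeffs_mem_invariantFunctions (α : F) {n : ℕ} (f : FreeTraceAlgebra F) :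
    entryCoeffs α n f ∈ invariantFunctions F (swapValues n) := by
  rw [mem_invariantFunctions]
  intro g
  rw [entryCoeffs_apply, entryCoeffs_apply, ← mapDomain_multilinearExponent]
  conv_lhs => rw [← rename_swapEntries_genericEntry]
  rw [coeff_rename_mapDomain _ swapEntries.injective]

theorem entryCoeffs_monomialLift [CharZero F] {α : F} (hα : α ≠ 0) {n : ℕ} (g h : Fin n → Fin 3) :
    entryCoeffs α n (monomialLift α (multilinearExponent g)) h =
      2⁻¹ * ((if g = h then 1 else 0) + (if g = swapValues n h then 1 else 0)) := by
  have hs : swapValues n g = h ↔ g = swapValues n h :=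
    ⟨fun e => by rw [← e, swapValues_swapValues], fun e => by rw [e, swapValues_swapValues]⟩
  rw [entryCoeffs_apply, genericEntry_monomialLift hα, mapDomain_multilinearExponent, coeff_smul,
    coeff_add, coeff_monomial, coeff_monomial, smul_eq_mul]
  simp only [multilinearExponent_injective.eq_iff, hs]

theorem map_entryCoeffs_MT [CharZero F] {α : F} (hα : α ≠ 0) (n : ℕ) :
    LinearMap.range ((entryCoeffs α n).domRestrict (MT F n)) =
      invariantFunctions F (swapValues n) := by
  apply le_antisymm
  · rintro _ ⟨f, rfl⟩
    exact entryCoeffs_mem_invariantFunctions α f.1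
  · intro v hv
    rw [mem_invariantFunctions] at hv
    -- The generic entry of this lift has the average of `v` and its swap as coefficients, which is
    -- `v` by invariance.
    refine ⟨⟨∑ g, v g • monomialLift α (multilinearExponent g), sum_mem fun g _ =>
      Submodule.smul_mem _ _ (monomialLift_mem_MT α (allLetters_multilinearExponent g))⟩, ?_⟩
    rw [LinearMap.domRestrict_apply]
    ext h
    rw [map_sum, Finset.sum_apply]
    simp only [map_smul, Pi.smul_apply, entryCoeffs_monomialLift hα, smul_eq_mul, mul_add, mul_ite,
      mul_one, mul_zero, Finset.sum_add_distrib, Finset.sum_ite_eq', Finset.mem_univ, if_true, hv]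
    ring

theorem codim_eq_finrank [CharZero F] {α : F} (hα : α ≠ 0) (n : ℕ) :
    (diagTrace ![α, α, 0]).codim n =
      Module.finrank F (invariantFunctions F (swapValues n)) := by
  have hker : Submodule.comap (MT F n).subtype
      ((diagTrace ![α, α, 0]).identities.asIdeal.restrictScalars F) =
      LinearMap.ker ((entryCoeffs α n).domRestrict (MT F n)) := by
    ext ⟨f, hf⟩
    rw [Submodule.mem_comap, Submodule.restrictScalars_mem, TwoSidedIdeal.mem_asIdeal,
      Submodule.subtype_apply, mem_identities_iff_genericEntry hα, LinearMap.mem_ker,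
      LinearMap.domRestrict_apply]
    refine ⟨fun h => ?_, genericEntry_eq_zero_of_entryCoeffs α hf⟩
    ext g
    rw [entryCoeffs_apply, h, coeff_zero, Pi.zero_apply]
  rw [AlgTrace.codim, quotientDim_eq_finrank_range _ hker, map_entryCoeffs_MT hα]

theorem card_fixed_swapValues (n : ℕ) :
    (Finset.univ.filter fun g : Fin n → Fin 3 => swapValues n g = g).card = 1 := by
  rw [Finset.card_eq_one]
  refine ⟨fun _ => 2, ?_⟩
  ext g
  rw [Finset.mem_filter, Finset.mem_singleton, funext_iff, funext_iff]
  simp only [Finset.mem_univ, true_and, swapValues_apply]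
  refine forall_congr' fun i => ?_
  generalize g i = k
  revert k
  decide

theorem two_mul_codim [CharZero F] {α : F} (hα : α ≠ 0) (n : ℕ) :
    2 * (diagTrace ![α, α, 0]).codim n = 3 ^ n + 1 := by
  rw [codim_eq_finrank hα, two_mul_finrank_invariantFunctions F swapValues_swapValues,
    card_fixed_swapValues]
  simp

end FreeTraceAlgebra

/-! ### Stirling number identities -/

theorem stirlingSecond_two_add_one (n : ℕ) : Nat.stirlingSecond (n + 1) 2 + 1 = 2 ^ n := by
  induction n with
  | zero => rfl
  | succ n ih =>
    rw [Nat.stirlingSecond_succ_succ, Nat.stirlingSecond_one_right, pow_succ, ← ih]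
    ring

theorem two_mul_stirlingSecond_three (n : ℕ) :
    2 * Nat.stirlingSecond (n + 1) 3 + 2 * 2 ^ n = 3 ^ n + 1 := by
  induction n with
  | zero => rfl
  | succ n ih =>
    have h := stirlingSecond_two_add_one n
    have h' : Nat.stirlingSecond (n + 1 + 1) 3 =
        3 * Nat.stirlingSecond (n + 1) 3 + Nat.stirlingSecond (n + 1) 2 :=
      Nat.stirlingSecond_succ_succ (n + 1) 2
    rw [h', pow_succ, pow_succ]
    omega

theorem sum_choose_mul_stirlingSecond_two (n : ℕ) :
    ∑ t ∈ Finset.Icc 2 n, n.choose t * Nat.stirlingSecond t 2 = Nat.stirlingSecond (n + 1) 3 := by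
  have hsub : ∑ t ∈ Finset.Icc 2 n, n.choose t * Nat.stirlingSecond t 2 =
      ∑ t ∈ Finset.range (n + 1), n.choose t * Nat.stirlingSecond t 2 := by
    apply Finset.sum_subset
    · intro t ht
      rw [Finset.mem_Icc] at ht
      rw [Finset.mem_range]
      omega
    · intro t ht ht'
      rw [Finset.mem_range] at ht
      rw [Finset.mem_Icc] at ht'
      rw [Nat.stirlingSecond_eq_zero_of_lt (by omega), mul_zero]
  -- For t ≥ 1 this is 2S(t,2) + 2 = 2^t; at t = 0 the left side is 2, hence the correction 1.
  -- Summation is then the binomial theorem for (2 + 1)^n.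
  have hterm : ∀ t, 2 * (n.choose t * Nat.stirlingSecond t 2) + 2 * n.choose t =
      2 ^ t * 1 ^ (n - t) * n.choose t + if t = 0 then 1 else 0 := by
    intro t
    cases t with
    | zero => simp
    | succ t =>
      rw [one_pow, pow_succ, ← stirlingSecond_two_add_one t, if_neg t.succ_ne_zero]
      ring
  have hsum : ∑ t ∈ Finset.range (n + 1), (2 * (n.choose t * Nat.stirlingSecond t 2)
      + 2 * n.choose t) = 3 ^ n + 1 := by
    rw [Finset.sum_congr rfl fun t _ => hterm t, Finset.sum_add_distrib, Finset.sum_ite_eq']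
    have h := add_pow 2 1 n
    simp only [Nat.cast_id] at h
    rw [← h]
    simp
  rw [Finset.sum_add_distrib, ← Finset.mul_sum, ← Finset.mul_sum, Nat.sum_range_choose,
    ← hsub] at hsum
  have h₃ := two_mul_stirlingSecond_three n
  omega

end

open FreeTraceAlgebra in
theorem mainTheorem3 {F : Type*} [Field F] [CharZero F] (α : F) (hα : α ≠ 0) :
    -- `Id^tr(D₃)` is the trace `T`-ideal generated by `f₁` and `g₃`
    IsLeast {I : TwoSidedIdeal (FreeTraceAlgebra F) | IsTraceTIdeal I ∧ f₁ ∈ I ∧ g₃ α ∈ I}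
      (diagTrace ![α, α, 0]).identities ∧
    -- the same for the stronger closure property, with `Tr(1) = tr(1) = 2α`
    IsLeast {I : TwoSidedIdeal (FreeTraceAlgebra F) |
        IsUnitalTraceTIdeal (2 * α) I ∧ f₁ ∈ I ∧ g₃ α ∈ I}
      (diagTrace ![α, α, 0]).identities ∧
    -- modulo the commutator, `g₃` is `Tr(f₃ x₃)`
    (∀ I : TwoSidedIdeal (FreeTraceAlgebra F), IsUnitalTraceTIdeal (2 * α) I → f₁ ∈ I →
      g₃ α - Tr (2 * α) (f₃ α * x 2) ∈ I) ∧
    -- the trace codimensions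
    ∀ n : ℕ,
      (diagTrace ![α, α, 0]).codim n =
          ∑ k ∈ Finset.range (n + 1), n.choose k +
            ∑ t ∈ Finset.Icc 2 n, n.choose t * Nat.stirlingSecond t 2 ∧
      (diagTrace ![α, α, 0]).codim n = 2 ^ n + Nat.stirlingSecond (n + 1) 3 ∧
      ((diagTrace ![α, α, 0]).codim n : ℚ) = (3 ^ n + 1) / 2 := by
  refine ⟨identities_isLeast_traceTIdeal hα, identities_isLeast_unitalTraceTIdeal hα,
    fun I hI hf => g₃_sub_Tr_f₃_mul_x_mem α hI hf, fun n => ?_⟩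
  have h := two_mul_codim hα n
  have h₃ := two_mul_stirlingSecond_three n
  refine ⟨?_, by omega, ?_⟩
  · rw [Nat.sum_range_choose, sum_choose_mul_stirlingSecond_two]
    omega
  · rw [eq_div_iff two_ne_zero, mul_comm]
    exact_mod_cast h
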